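/- There is a function $o:\mathbb N\to\mathbb R$ with $o(m)\to 0$ as $m\to\infty$ such that the following holds for every finite simple graph $G=(V,E)$ with $E\neq\emptyset$. Suppose that exactly one unknown edge $e\in E$ is defective, and that any set $S\subseteq V$ may be tested, the outcome being positive if $S\cap e\ne\emptyset$ and negative otherwise. Then there is a deterministic algorithm with 3 stages (the tests within one stage are performed in parallel and may depend only on the outcomes of the tests of the earlier stages; a stage may be empty) which, whichever edge $e\in E$ is the defective one, identifies $e$ using in total at most $(1+o(|E|))\log_2|E|$ tests. -/

import Mathlib

open Filter Topology

/-- A deterministic group testing algorithm on the vertex set `V` with `s` stages, as a decision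
tree. A stage is a finite family of tests (arbitrary sets of vertices) that are all performed in
parallel; the rest of the algorithm may depend on all outcomes of the stage (and, because of the
nesting, on the outcomes of the earlier stages). After the last stage an edge is announced. A stage
may consist of no test at all, so "`s` stages" means "at most `s` stages". -/
inductive StagedAlgorithm (V : Type*) : ℕ → Type _
  | announce (e : Sym2 V) : StagedAlgorithm V 0
  | stage {s : ℕ} (m : ℕ) (tests : Fin m → Set V)
      (next : (Fin m → Bool) → StagedAlgorithm V s) : StagedAlgorithm V (s + 1)

open Classical in
/-- The outcome of the test `S` when `e` is the defective edge: positive if and only if `S` contains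
an endpoint of `e`. -/
noncomputable def testOutcome {V : Type*} (e : Sym2 V) (S : Set V) : Bool :=
  decide (∃ v ∈ S, v ∈ e)

namespace StagedAlgorithm

/-- The edge that the algorithm announces when `e` is the defective edge. -/
noncomputable def result {V : Type*} (e : Sym2 V) : {s : ℕ} → StagedAlgorithm V s → Sym2 V
  | _, announce a => a
  | _, stage _ tests next => result e (next fun i => testOutcome e (tests i))

/-- The total number of tests that the algorithm performs, over all stages, when `e` is the
defective edge. -/
noncomputable def numTests {V : Type*} (e : Sym2 V) : {s : ℕ} → StagedAlgorithm V s → ℕ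
  | _, announce _ => 0
  | _, stage m tests next => m + numTests e (next fun i => testOutcome e (tests i))

/-- The algorithm finds the defective edge of `G`, whichever edge of `G` is the defective one. -/
def FindsDefectiveEdge {V : Type*} {s : ℕ} (A : StagedAlgorithm V s) (G : SimpleGraph V) : Prop :=
  ∀ e ∈ G.edgeSet, A.result e = e

end StagedAlgorithm

/-! Let the graph have fewer than `2 ^ L` edges. Stage one sorts the vertices by order of magnitude
of their degrees, in windows of `q` binary digits, and spends one test per class; with `q` about `L
/ R` there are only `R + 1` tests. The outcome tells which classes meet the defective edge. By the
degree sum, the size of a class times its largest degree is at most `2 ^ (L + 1 + q)`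
(`identifiable_edgeSet`).

If the endpoints lie in different classes, every candidate has exactly one endpoint in the higher
one; binary codes find that endpoint, then its neighbour (`Identifiable.of_cut`). If they share a
class, stage two gives each vertex a random word and observes the join of the two endpoint words.
With length `L + 1 + 5 * q` this leaves at most `2 * l ^ 2` candidates, with `l` depending on `R`
only, and stage three tests them singly (`Identifiable.of_subset_inner`).

Few candidates remain because edges without large stars and matchings are few (`card_edges_le`); a
union bound excludes `l`-stars and `l`-matchings whose joins all agree (`exists_code`). Bits equal
to 0 with probability `√(1 / 2)` make joins uniform, which handles matchings. Fixing the weight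
prevents a heavy word from hiding those of its neighbours, which handles stars, and costs only a
factor `k + 1` per word (`exists_weight`).

The total is `L * (1 + 5 / R)` plus a constant depending on `R`; let `L` and then `R` tend to
infinity. -/

/-- Some algorithm with `s` stages identifies every edge in `E` with at most `b` tests. -/
def Identifiable {V : Type*} (s : ℕ) (E : Set (Sym2 V)) (b : ℕ) : Prop :=
  ∃ A : StagedAlgorithm V s, ∀ e ∈ E, A.result e = e ∧ A.numTests e ≤ b

/-! ### Elementary search strategies -/

section Identifiable

variable {V : Type*}

lemma testOutcome_eq_true {e : Sym2 V} {S : Set V} :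
    testOutcome e S = true ↔ ∃ v ∈ S, v ∈ e := by
  simp [testOutcome]

lemma testOutcome_mk_eq_true {u v : V} {S : Set V} :
    testOutcome s(u, v) S = true ↔ u ∈ S ∨ v ∈ S := by
  simp only [testOutcome_eq_true, Sym2.mem_iff]
  constructor
  · rintro ⟨w, hw, rfl | rfl⟩ <;> simp [hw]
  · rintro (h | h)
    exacts [⟨u, h, Or.inl rfl⟩, ⟨v, h, Or.inr rfl⟩]

lemma Identifiable.mono {s : ℕ} {E F : Set (Sym2 V)} {b c : ℕ} (h : Identifiable s E b)
    (hE : F ⊆ E) (hb : b ≤ c) : Identifiable s F c := by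
  obtain ⟨A, hA⟩ := h
  exact ⟨A, fun e he => ⟨(hA e (hE he)).1, (hA e (hE he)).2.trans hb⟩⟩

lemma Identifiable.of_subsingleton [Nonempty (Sym2 V)] {E : Set (Sym2 V)} (hE : E.Subsingleton) :
    Identifiable 0 E 0 := by
  obtain rfl | ⟨a, ha⟩ := E.eq_empty_or_nonempty
  · exact ⟨.announce (Classical.arbitrary _), by simp⟩
  · exact ⟨.announce a, fun e he => ⟨hE ha he, le_rfl⟩⟩

lemma Identifiable.stage {s m b : ℕ} {E : Set (Sym2 V)} (tests : Fin m → Set V)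
    (h : ∀ o : Fin m → Bool, Identifiable s {e ∈ E | (fun i => testOutcome e (tests i)) = o} b) :
    Identifiable (s + 1) E (m + b) := by
  choose A hA using h
  refine ⟨.stage m tests A, fun e he => ?_⟩
  have := hA _ e ⟨he, rfl⟩
  exact ⟨this.1, Nat.add_le_add_left this.2 m⟩

lemma Identifiable.add_stages [Nonempty (Sym2 V)] {E : Set (Sym2 V)} (hE : E.Subsingleton) (s : ℕ) :
    Identifiable s E 0 := by
  induction s with
  | zero => exact .of_subsingleton hE
  | succ s ih => exact .stage (m := 0) Fin.elim0 fun o => ih.mono (Set.sep_subset _ _) le_rfl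

lemma Identifiable.of_injOn [Nonempty (Sym2 V)] {m : ℕ} {E : Set (Sym2 V)} (tests : Fin m → Set V)
    (h : Set.InjOn (fun e i => testOutcome e (tests i)) E) : Identifiable 1 E m :=
  .stage tests fun _ => .of_subsingleton fun _ he _ hf => h he.1 hf.1 (he.2.trans hf.2.symm)

/-- Testing every edge on its own. -/
lemma Identifiable.of_ncard_le [Nonempty (Sym2 V)] {E : Set (Sym2 V)} (hfin : E.Finite)
    (hE : ∀ e ∈ E, ¬ e.IsDiag) {m : ℕ} (hm : E.ncard ≤ m) : Identifiable 1 E m := by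
  refine Identifiable.mono (b := E.ncard) ?_ subset_rfl hm
  have : Finite E := hfin
  let φ : Fin E.ncard ≃ E := (Finite.equivFinOfCardEq rfl).symm
  -- The complement of an edge tests negative only if both endpoints of the defective edge lie in
  -- that edge.
  refine .of_injOn (fun i => {v | v ∉ (φ i : Sym2 V)}) fun e he f hf hef => ?_
  have h := congrFun hef (φ.symm ⟨e, he⟩)
  have he0 : testOutcome e {v | v ∉ e} = false := by
    rw [← Bool.not_eq_true, testOutcome_eq_true]
    simp
  simp only [Equiv.apply_symm_apply, he0] at h
  have h' : ¬ testOutcome f {v | v ∉ e} = true := by simp [← h]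
  rw [testOutcome_eq_true] at h'
  push Not at h'
  induction f with
  | h x y =>
    have hxy : x ≠ y := fun hxy => hE _ hf (by simp [hxy])
    have hx : x ∈ e := by
      by_contra hx
      exact h' x hx (by simp)
    have hy : y ∈ e := by
      by_contra hy
      exact h' y hy (by simp)
    exact (Sym2.mem_and_mem_iff hxy).1 ⟨hx, hy⟩

lemma exists_injOn_boolVector {X : Set V} (hX : X.Finite) {k : ℕ} (h : X.ncard ≤ 2 ^ k) :
    ∃ c : V → Fin k → Bool, Set.InjOn c X := by
  have : Finite X := hX
  have := Fintype.ofFinite X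
  have hcard : Fintype.card X ≤ Fintype.card (Fin k → Bool) := by
    rw [← Nat.card_eq_fintype_card, Nat.card_coe_set_eq]
    simpa using h
  obtain ⟨φ⟩ := Function.Embedding.nonempty_of_card_le hcard
  classical
  refine ⟨fun v => if h : v ∈ X then φ ⟨v, h⟩ else fun _ => false, fun u hu v hv huv => ?_⟩
  simpa [hu, hv] using huv

/-- An edge at a known vertex is found by a binary code on the neighbours. -/
lemma Identifiable.of_mem [Nonempty (Sym2 V)] {E : Set (Sym2 V)} (hE : ∀ e ∈ E, ¬ e.IsDiag) (v : V)
    (hv : ∀ e ∈ E, v ∈ e) {k : ℕ} (hfin : {w | s(v, w) ∈ E}.Finite)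
    (hk : {w | s(v, w) ∈ E}.ncard ≤ 2 ^ k) : Identifiable 1 E k := by
  obtain ⟨c, hc⟩ := exists_injOn_boolVector hfin hk
  -- The known endpoint must stay out of the tests: it would make them positive whatever the other
  -- endpoint is.
  refine .of_injOn (fun i => {w | w ≠ v ∧ c w i = true}) fun e he f hf hef => ?_
  obtain ⟨x, rfl⟩ := hv e he
  obtain ⟨y, rfl⟩ := hv f hf
  have hx : x ≠ v := fun h => hE _ he (by simp [h])
  have hy : y ≠ v := fun h => hE _ hf (by simp [h])
  have : c x = c y := by
    funext i
    have h := congrFun hef i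
    rw [Bool.eq_iff_iff, testOutcome_mk_eq_true, testOutcome_mk_eq_true] at h
    simpa [hx, hy] using h
  rw [hc he hf this]

/-- If every edge has exactly one endpoint in `X`, first that endpoint is found by a binary code,
then the other one. -/
lemma Identifiable.of_cut [Finite V] [Nonempty (Sym2 V)] {G : SimpleGraph V} {E : Set (Sym2 V)}
    (hE : E ⊆ G.edgeSet) (X : Set V) (hX : ∀ e ∈ E, ∃ u ∉ X, ∃ v ∈ X, e = s(u, v)) {k l : ℕ}
    (hk : X.ncard ≤ 2 ^ k) (hl : ∀ v ∈ X, (G.neighborSet v).ncard ≤ 2 ^ l) :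
    Identifiable 2 E (k + l) := by
  obtain ⟨c, hc⟩ := exists_injOn_boolVector X.toFinite hk
  refine .stage (fun i => {v | v ∈ X ∧ c v i = true}) fun o => ?_
  set F := {e ∈ E | (fun i => testOutcome e {v | v ∈ X ∧ c v i = true}) = o} with hF
  obtain h0 | ⟨e, he⟩ := F.eq_empty_or_nonempty
  · exact (Identifiable.add_stages (by simp [h0]) 1).mono subset_rfl (Nat.zero_le _)
  have key : ∀ u ∉ X, ∀ v ∈ X, s(u, v) ∈ F → c v = o := by
    rintro u hu v hv ⟨-, h⟩
    rw [← h]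
    funext i
    rw [Bool.eq_iff_iff, testOutcome_mk_eq_true]
    simp [hu, hv]
  obtain ⟨u, hu, v, hv, rfl⟩ := hX e he.1
  refine .of_mem (fun e he => G.not_isDiag_of_mem_edgeSet (hE he.1)) v ?_ (Set.toFinite _)
    ((Set.ncard_le_ncard ?_ (Set.toFinite _)).trans (hl v hv))
  · intro f hf
    obtain ⟨x, hx, y, hy, rfl⟩ := hX f hf.1
    rw [hc hv hy ((key u hu v hv he).trans (key x hx y hy hf).symm)]
    simp
  · intro w hw
    exact hE hw.1

end Identifiable

/-! ### Counting labelings with prescribed values on stars and matchings -/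

section Counting

lemma mul_mul_le_of_mul_le {a b c n p t s : ℕ} (h : a * n ≤ b * t) (h' : b * p ≤ c * s) :
    a * (n * p) ≤ c * (t * s) :=
  calc a * (n * p) = a * n * p := by ring
    _ ≤ b * t * p := Nat.mul_le_mul_right _ h
    _ = b * p * t := by ring
    _ ≤ c * s * t := Nat.mul_le_mul_right _ h'
    _ = c * (t * s) := by ring

/-- Double counting by resampling the part of a configuration that `get` reads. -/
lemma card_filter_mul_card_le {Ω β : Type*} [Fintype Ω] [Fintype β] (get : Ω → β)
    (set : Ω → β → Ω) (get_set : ∀ A b, get (set A b) = b)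
    (set_set_get : ∀ A b, set (set A b) (get A) = A)
    (Q : Ω → Prop) (R : Ω → β → Prop)
    [DecidablePred Q] [∀ A, DecidablePred (R A)] [DecidablePred fun A => Q A ∧ R A (get A)]
    (hQ : ∀ A b, Q A → Q (set A b))
    (hR : ∀ A b c, R A c → R (set A b) c) {T : ℕ}
    (hT : ∀ A, (Finset.univ.filter (R A)).card ≤ T) :
    (Finset.univ.filter fun A => Q A ∧ R A (get A)).card * Fintype.card β ≤
      (Finset.univ.filter Q).card * T := by
  calc (Finset.univ.filter fun A => Q A ∧ R A (get A)).card * Fintype.card β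
      = ((Finset.univ.filter fun A => Q A ∧ R A (get A)) ×ˢ (Finset.univ : Finset β)).card := by
        rw [Finset.card_product, Finset.card_univ]
    _ ≤ ((Finset.univ.filter Q).sigma fun A => Finset.univ.filter (R A)).card := by
        -- Overwriting with the fresh value while remembering the old one loses nothing: both can be
        -- read back.
        refine Finset.card_le_card_of_injOn (fun x => ⟨set x.1 x.2, get x.1⟩) ?_ ?_
        · rintro ⟨A, b⟩ h
          simp only [Finset.coe_product, Set.mem_prod, Finset.mem_coe, Finset.mem_filter,
            Finset.mem_univ, true_and, and_true] at h
          simp only [Finset.mem_coe, Finset.mem_sigma, Finset.mem_filter, Finset.mem_univ, true_and]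
          exact ⟨hQ _ _ h.1, hR _ _ _ h.2⟩
        · rintro ⟨A, b⟩ - ⟨A', b'⟩ - h
          simp only [Sigma.mk.injEq, heq_eq_eq] at h
          have hb : b = b' := by rw [← get_set A b, h.1, get_set]
          have hA : A = A' := by rw [← set_set_get A b, h.1, h.2, set_set_get]
          rw [hA, hb]
    _ = ∑ A ∈ Finset.univ.filter Q, (Finset.univ.filter (R A)).card := Finset.card_sigma _ _
    _ ≤ (Finset.univ.filter Q).card * T := by
        rw [← smul_eq_mul]
        exact Finset.sum_le_card_nsmul _ _ _ fun A _ => hT A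

variable {V α ζ : Type*} [Fintype V] [DecidableEq V] [Fintype α] [DecidableEq ζ]
  (f : α → α → ζ) (z : ζ)

/-- Once the centre's label is fixed, the leaves are independent, so each costs a factor `T /
Fintype.card α`. -/
lemma card_star_mul_le {T : ℕ} (hT : ∀ b, (Finset.univ.filter fun c => f b c = z).card ≤ T) (u : V)
    (W : Finset V) (hu : u ∉ W) :
    (Finset.univ.filter fun A : V → α => ∀ w ∈ W, f (A u) (A w) = z).card *
      Fintype.card α ^ W.card ≤ Fintype.card (V → α) * T ^ W.card := by
  induction W using Finset.induction_on with
  | empty => simp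
  | insert w W hw ih =>
    simp only [Finset.mem_insert, not_or] at hu
    have h := card_filter_mul_card_le (fun A : V → α => A w) (fun A b => Function.update A w b)
      (by simp) (by simp) (fun A => ∀ w ∈ W, f (A u) (A w) = z) (fun A b => f (A u) b = z)
      (by
        intro A b hA x hx
        have : x ≠ w := by rintro rfl; exact hw hx
        simpa [hu.1, this] using hA x hx)
      (by intro A b c h; simpa [hu.1] using h) (fun A => hT (A u))
    have e : (Finset.univ.filter fun A : V → α => ∀ x ∈ insert w W, f (A u) (A x) = z) =
        Finset.univ.filter fun A : V → α => (∀ w ∈ W, f (A u) (A w) = z) ∧ f (A u) (A w) = z := by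
      ext A
      simp [and_comm]
    rw [e, Finset.card_insert_of_notMem hw, pow_succ', pow_succ']
    exact mul_mul_le_of_mul_le h (ih hu.2)

/-- The pairs in `M` are formed by distinct vertices and have no vertex in common. -/
def IsPairMatching {V : Type*} (M : Finset (V × V)) : Prop :=
  (∀ p ∈ M, p.1 ≠ p.2) ∧ ∀ p ∈ M, ∀ q ∈ M, p ≠ q →
    p.1 ≠ q.1 ∧ p.1 ≠ q.2 ∧ p.2 ≠ q.1 ∧ p.2 ≠ q.2

lemma IsPairMatching.subset {V : Type*} {M N : Finset (V × V)} (hN : IsPairMatching N) (h : M ⊆ N) :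
    IsPairMatching M :=
  ⟨fun p hp => hN.1 p (h hp), fun p hp q hq => hN.2 p (h hp) q (h hq)⟩

/-- Disjoint pairs are independent, so each costs a factor `T / Fintype.card α ^ 2`. -/
lemma card_matching_mul_le {T : ℕ}
    (hT : (Finset.univ.filter fun p : α × α => f p.1 p.2 = z).card ≤ T)
    (M : Finset (V × V)) (hM : IsPairMatching M) :
    (Finset.univ.filter fun A : V → α => ∀ p ∈ M, f (A p.1) (A p.2) = z).card *
      (Fintype.card α ^ 2) ^ M.card ≤ Fintype.card (V → α) * T ^ M.card := by
  induction M using Finset.induction_on with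
  | empty => simp
  | insert p M hp ih =>
    have hne : p.1 ≠ p.2 := hM.1 p (Finset.mem_insert_self _ _)
    have h := card_filter_mul_card_le (fun A : V → α => (A p.1, A p.2))
      (fun A b => Function.update (Function.update A p.1 b.1) p.2 b.2)
      (by simp [hne])
      (by
        intro A b
        funext x
        by_cases h2 : x = p.2
        · simp [h2]
        · by_cases h1 : x = p.1
          · simp [h1, hne]
          · simp [h1, h2])
      (fun A => ∀ p ∈ M, f (A p.1) (A p.2) = z) (fun _ b => f b.1 b.2 = z)
      (by
        intro A b hA q hq
        have hpq : p ≠ q := by rintro rfl; exact hp hq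
        obtain ⟨h1, h2, h3, h4⟩ := hM.2 p (Finset.mem_insert_self _ _) q
          (Finset.mem_insert_of_mem hq) hpq
        simpa [h1.symm, h2.symm, h3.symm, h4.symm] using hA q hq)
      (by simp) (fun A => hT)
    have e : (Finset.univ.filter fun A : V → α => ∀ x ∈ insert p M, f (A x.1) (A x.2) = z) =
        Finset.univ.filter fun A : V → α =>
          (∀ w ∈ M, f (A w.1) (A w.2) = z) ∧ f (A p.1) (A p.2) = z := by
      ext A
      simp only [Finset.forall_mem_insert, Finset.mem_filter, Finset.mem_univ, true_and]
      exact and_comm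
    rw [e, Finset.card_insert_of_notMem hp, pow_succ' (_ ^ 2), pow_succ' T]
    rw [Fintype.card_prod, ← pow_two] at h
    exact mul_mul_le_of_mul_le h (ih (hM.subset (Finset.subset_insert _ _)))

end Counting

/-! ### Joins of constant-weight words -/

section ConstantWeight

variable {k : ℕ}

/-- The number of ones of a binary word. -/
def boolWeight (x : Fin k → Bool) : ℕ := (Finset.univ.filter fun i => x i = true).card

lemma boolWeight_le (x : Fin k → Bool) : boolWeight x ≤ k := by
  simpa [boolWeight] using Finset.card_filter_le Finset.univ fun i => x i = true

/-- The probability of a bit, such that the join of two independent bits is a fair bit. -/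
noncomputable def bitMass (b : Bool) : ℝ := if b then 1 - √(1 / 2) else √(1 / 2)

lemma sqrt_half_mul_self : √(1 / 2 : ℝ) * √(1 / 2) = 1 / 2 :=
  Real.mul_self_sqrt (by norm_num)

lemma sqrt_half_lt_one : √(1 / 2 : ℝ) < 1 := by
  nlinarith [sqrt_half_mul_self, Real.sqrt_nonneg (1 / 2)]

lemma sqrt_half_gt : (7 / 10 : ℝ) < √(1 / 2) := by
  nlinarith [sqrt_half_mul_self, Real.sqrt_nonneg (1 / 2)]

lemma bitMass_pos (b : Bool) : 0 < bitMass b := by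
  cases b
  · simp [bitMass]
  · simpa [bitMass] using sqrt_half_lt_one

lemma sum_bitMass : ∑ b, bitMass b = 1 := by
  simp [bitMass]

lemma sum_bitMass_or (b : Bool) :
    ∑ p : Bool × Bool with (p.1 || p.2) = b, bitMass p.1 * bitMass p.2 = 1 / 2 := by
  have h := sqrt_half_mul_self
  rw [Finset.sum_filter, Fintype.sum_prod_type]
  cases b
  · simpa [bitMass] using h
  · simp only [bitMass, Fintype.sum_bool]
    simp only [Bool.or_true, Bool.or_false, if_true, Bool.false_eq_true, if_false]
    linarith

lemma prod_bitMass (x : Fin k → Bool) :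
    ∏ i, bitMass (x i) = (1 - √(1 / 2)) ^ boolWeight x * √(1 / 2) ^ (k - boolWeight x) := by
  have h := Finset.card_filter_add_card_filter_not (s := (Finset.univ : Finset (Fin k)))
    (fun i => x i = true)
  simp only [Finset.card_univ, Fintype.card_fin] at h
  simp only [bitMass, Finset.prod_ite, Finset.prod_const, boolWeight]
  congr 2
  omega

lemma sum_prod_bitMass : ∑ x : Fin k → Bool, ∏ i, bitMass (x i) = 1 := by
  have h := Finset.prod_univ_sum (fun _ : Fin k => (Finset.univ : Finset Bool))
    (fun _ b => bitMass b)
  rw [Fintype.piFinset_univ] at h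
  rw [← h, sum_bitMass, Finset.prod_const_one]

/-- The bitwise join of two words. -/
def boolJoin (x y : Fin k → Bool) : Fin k → Bool := fun i => x i || y i

lemma sum_prod_bitMass_join (z : Fin k → Bool) :
    ∑ p : (Fin k → Bool) × (Fin k → Bool) with boolJoin p.1 p.2 = z,
      (∏ i, bitMass (p.1 i)) * ∏ i, bitMass (p.2 i) = (1 / 2) ^ k := by
  have h := Finset.prod_univ_sum
    (fun i : Fin k => Finset.univ.filter fun p : Bool × Bool => (p.1 || p.2) = z i)
    (fun _ p => bitMass p.1 * bitMass p.2)
  simp only [sum_bitMass_or, Finset.prod_const, Finset.card_univ, Fintype.card_fin] at h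
  rw [h]
  refine Finset.sum_bij' (fun p _ i => (p.1 i, p.2 i))
    (fun g _ => (fun i => (g i).1, fun i => (g i).2)) ?_ ?_ ?_ ?_ ?_
  · intro p hp
    simp only [Finset.mem_filter, Finset.mem_univ, true_and] at hp
    simp [Fintype.mem_piFinset, ← hp, boolJoin]
  · intro g hg
    simp only [Fintype.mem_piFinset, Finset.mem_filter, Finset.mem_univ, true_and] at hg ⊢
    funext i
    exact hg i
  · intros; rfl
  · intros; rfl
  · intro p _
    rw [Finset.prod_mul_distrib]

/-- The words of weight `a`. -/
abbrev ConstantWeight (k a : ℕ) : Type := {x : Fin k → Bool // boolWeight x = a}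

/-- Pigeonhole over the `k + 1` weights: words of equal weight have equal mass, and some weight
carries at least the average share. -/
lemma exists_le_card_mul (k : ℕ) : ∃ a ≤ k,
    1 ≤ (k + 1) * (Fintype.card (ConstantWeight k a) *
      ((1 - √(1 / 2 : ℝ)) ^ a * √(1 / 2) ^ (k - a))) := by
  have h : ∑ a ∈ Finset.range (k + 1), (Fintype.card (ConstantWeight k a) *
      ((1 - √(1 / 2 : ℝ)) ^ a * √(1 / 2) ^ (k - a))) = 1 := by
    refine Eq.trans ?_ (sum_prod_bitMass (k := k))
    rw [← Finset.sum_fiberwise_of_maps_to (s := Finset.univ)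
      (t := Finset.range (k + 1)) (g := boolWeight)
      (fun x _ => Finset.mem_range.2 (Nat.lt_succ_of_le (boolWeight_le x)))]
    refine Finset.sum_congr rfl fun a _ => ?_
    rw [Fintype.card_subtype, ← nsmul_eq_mul]
    refine (Finset.sum_eq_card_nsmul fun x hx => ?_).symm
    rw [prod_bitMass, (Finset.mem_filter.1 hx).2]
  obtain ⟨a, ha, h'⟩ := Finset.exists_le_of_sum_le (s := Finset.range (k + 1))
    (f := fun _ => (1 / (k + 1) : ℝ)) ⟨0, by simp⟩ (by
      rw [h, Finset.sum_const, Finset.card_range, nsmul_eq_mul]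
      push_cast
      rw [mul_one_div_cancel (by positivity)])
  refine ⟨a, Nat.lt_succ_iff.1 (Finset.mem_range.1 ha), ?_⟩
  rwa [div_le_iff₀' (by positivity)] at h'

/-- Off the support of `b` the join dictates the bits of `c`; only the `a` bits on the support are
free. -/
lemma card_join_eq_le {a : ℕ} (b : ConstantWeight k a) (z : Fin k → Bool) :
    (Finset.univ.filter fun c : ConstantWeight k a => boolJoin b.1 c.1 = z).card ≤ 2 ^ a := by
  have hcard : Fintype.card ({i // b.1 i = true} → Bool) = 2 ^ a := by
    rw [Fintype.card_fun, Fintype.card_bool, Fintype.card_subtype]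
    congr 1
    exact b.2
  rw [← hcard, ← Finset.card_univ]
  refine Finset.card_le_card_of_injOn (fun c i => c.1 i) (fun _ _ => Finset.mem_univ _) ?_
  intro c hc d hd hcd
  simp only [Finset.coe_filter, Finset.mem_univ, true_and, Set.mem_ofPred_eq] at hc hd
  refine Subtype.ext (funext fun i => ?_)
  by_cases hi : b.1 i = true
  · exact congrFun hcd ⟨i, hi⟩
  · have h := congrFun (hc.trans hd.symm) i
    simpa [boolJoin, hi] using h

/-- Some constant-weight code is as good as independent random bits, up to a factor `k + 1` for
each word. -/
lemma exists_weight (k : ℕ) : ∃ a, 0 < Fintype.card (ConstantWeight k a) ∧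
    (2 ^ a) ^ 2 * 2 ^ k ≤ (Fintype.card (ConstantWeight k a)) ^ 2 * (k + 1) ^ 2 ∧
    ∀ z, (Finset.univ.filter fun p : ConstantWeight k a × ConstantWeight k a =>
      boolJoin p.1.1 p.2.1 = z).card * 2 ^ k ≤
        (Fintype.card (ConstantWeight k a)) ^ 2 * (k + 1) ^ 2 := by
  obtain ⟨a, hak, ha⟩ := exists_le_card_mul k
  set N := Fintype.card (ConstantWeight k a)
  set w : ℝ := (1 - √(1 / 2 : ℝ)) ^ a * √(1 / 2) ^ (k - a) with hw
  have h1 := sqrt_half_lt_one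
  have h7 := sqrt_half_gt
  have hs := sqrt_half_mul_self
  have hw0 : 0 < w := mul_pos (pow_pos (by linarith) _) (pow_pos (by linarith) _)
  have hsq : 1 ≤ (N : ℝ) ^ 2 * (k + 1) ^ 2 * w ^ 2 := by
    calc (1 : ℝ) = 1 ^ 2 := by norm_num
      _ ≤ ((k + 1) * (N * w)) ^ 2 := pow_le_pow_left₀ zero_le_one ha 2
      _ = _ := by ring
  -- `w ^ 2` is the mass of a pair of words of weight `a`, so both bounds reduce to estimates of
  -- mass.
  have key : ∀ c : ℕ, (c : ℝ) * 2 ^ k * w ^ 2 ≤ 1 → c * 2 ^ k ≤ N ^ 2 * (k + 1) ^ 2 := by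
    intro c hc
    have : (c : ℝ) * 2 ^ k * w ^ 2 ≤ (N : ℝ) ^ 2 * (k + 1) ^ 2 * w ^ 2 := hc.trans hsq
    have := le_of_mul_le_mul_right this (by positivity)
    exact_mod_cast this
  refine ⟨a, Nat.pos_of_ne_zero fun h0 => ?_, ?_, fun z => ?_⟩
  · rw [show N = 0 from h0] at ha
    norm_num at ha
  · refine key _ ?_
    have e : (((2 ^ a) ^ 2 : ℕ) : ℝ) * 2 ^ k * w ^ 2 = (8 * (1 - √(1 / 2)) ^ 2) ^ a := by
      have hk : (2 : ℝ) ^ k = 2 ^ a * 2 ^ (k - a) := by rw [← pow_add]; congr 1; omega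
      have hh : (2 : ℝ) ^ (k - a) * (√(1 / 2) ^ (k - a)) ^ 2 = 1 := by
        rw [pow_right_comm, pow_two, hs, ← mul_pow]
        norm_num
      calc _ = (2 ^ 2 * 2 * (1 - √(1 / 2)) ^ 2) ^ a *
            ((2 : ℝ) ^ (k - a) * (√(1 / 2) ^ (k - a)) ^ 2) := by
              rw [hk, hw, mul_pow _ ((1 - √(1 / 2)) ^ 2) a, mul_pow _ 2 a]
              push_cast
              rw [← pow_mul 2 2 a, mul_comm 2 a, pow_mul 2 a 2,
                pow_right_comm (1 - √(1 / 2)) 2 a]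
              ring
        _ = _ := by rw [hh, mul_one]; norm_num
    -- The base is below 1 because `√(1 / 2) > 7 / 10`.
    rw [e]
    refine pow_le_one₀ (by positivity) ?_
    nlinarith
  · refine key _ ?_
    have hp : ((Finset.univ.filter fun p : ConstantWeight k a × ConstantWeight k a =>
        boolJoin p.1.1 p.2.1 = z).card : ℝ) * w ^ 2 ≤ (1 / 2) ^ k := by
      let φ : ConstantWeight k a × ConstantWeight k a ↪ (Fin k → Bool) × (Fin k → Bool) :=
        (Function.Embedding.subtype _).prodMap (Function.Embedding.subtype _)
      calc _ = ∑ p ∈ (Finset.univ.filter fun p : ConstantWeight k a × ConstantWeight k a =>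
            boolJoin p.1.1 p.2.1 = z).map φ, (∏ i, bitMass (p.1 i)) * ∏ i, bitMass (p.2 i) := by
            rw [Finset.sum_map, ← nsmul_eq_mul]
            refine (Finset.sum_eq_card_nsmul fun p _ => ?_).symm
            change (∏ i, bitMass (p.1.1 i)) * ∏ i, bitMass (p.2.1 i) = w ^ 2
            rw [prod_bitMass, prod_bitMass, p.1.2, p.2.2, pow_two]
        _ ≤ _ := by
            rw [← sum_prod_bitMass_join z]
            refine Finset.sum_le_sum_of_subset_of_nonneg ?_ fun p _ _ =>
              mul_nonneg (Finset.prod_nonneg fun i _ => (bitMass_pos _).le)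
                (Finset.prod_nonneg fun i _ => (bitMass_pos _).le)
            intro p hp
            obtain ⟨r, hr, rfl⟩ := Finset.mem_map.1 hp
            exact Finset.mem_filter.2 ⟨Finset.mem_univ _, (Finset.mem_filter.1 hr).2⟩
    calc _ = ((Finset.univ.filter fun p : ConstantWeight k a × ConstantWeight k a =>
        boolJoin p.1.1 p.2.1 = z).card : ℝ) * w ^ 2 * 2 ^ k := by ring
      _ ≤ (1 / 2) ^ k * 2 ^ k := by gcongr
      _ = 1 := by rw [← mul_pow]; norm_num

end ConstantWeight

/-! ### The random code and the candidates it leaves -/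

section CodeExistence

/-- Union bound: `c * d ^ l` configurations, each of probability at most `(t / n) ^ l`, with `d * t
/ n ≤ 2 ^ (-τ)`. The 2 in `hl` yields the quarter. -/
lemma four_mul_card_le {B β Ω c t d n τ l k : ℕ} (hn : 0 < n) (hB : B ≤ c * (d ^ l * β))
    (hβ : β * n ^ l ≤ Ω * t ^ l) (hc : c ≤ 2 ^ (2 * k)) (hd : d * t * 2 ^ τ ≤ n)
    (hl : 2 * k + 2 ≤ τ * l) : 4 * B ≤ Ω := by
  have h : 4 * B * (2 ^ (2 * k) * n ^ l) ≤ Ω * (2 ^ (2 * k) * n ^ l) :=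
    calc 4 * B * (2 ^ (2 * k) * n ^ l) = 2 ^ (2 * k + 2) * (B * n ^ l) := by ring
      _ ≤ 2 ^ (τ * l) * (c * (d ^ l * β) * n ^ l) := by gcongr; norm_num
      _ = 2 ^ (τ * l) * c * d ^ l * (β * n ^ l) := by ring
      _ ≤ 2 ^ (τ * l) * c * d ^ l * (Ω * t ^ l) := by gcongr
      _ = c * Ω * (d * t * 2 ^ τ) ^ l := by rw [mul_pow, mul_pow, ← pow_mul]; ring
      _ ≤ 2 ^ (2 * k) * Ω * n ^ l := by gcongr
      _ = Ω * (2 ^ (2 * k) * n ^ l) := by ring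
  exact Nat.le_of_mul_le_mul_right h (by positivity)

/-- A code whose joins identify the pairs in `P` up to a bounded star and matching number. -/
lemma exists_code {V : Type*} [Fintype V] [DecidableEq V] (P : Finset (V × V)) (X : Finset V)
    {k τ l D : ℕ} (hX : X.card ≤ 2 ^ k) (hP : P.card * 2 ^ (4 * τ) ≤ 2 ^ k)
    (hne : ∀ p ∈ P, p.1 ≠ p.2)
    (hD : ∀ u ∈ X, (Finset.univ.filter fun w => (u, w) ∈ P).card ≤ D)
    (hD2 : D ^ 2 * 2 ^ (4 * τ) ≤ 2 ^ k) (hτ : k + 1 ≤ 2 ^ τ) (hl : 2 * k + 2 ≤ τ * l) :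
    ∃ A : V → Fin k → Bool, ∀ z,
      (∀ u ∈ X, ∀ W : Finset V, (∀ w ∈ W, (u, w) ∈ P ∧ boolJoin (A u) (A w) = z) → W.card < l) ∧
      ∀ M ⊆ P, IsPairMatching M → (∀ p ∈ M, boolJoin (A p.1) (A p.2) = z) → M.card < l := by
  obtain ⟨a, hN, ha, hQ⟩ := exists_weight k
  set N := Fintype.card (ConstantWeight k a) with hNdef
  set Ω := Fintype.card (V → ConstantWeight k a) with hΩ
  have hΩ0 : 0 < Ω := by
    rw [hΩ, Fintype.card_fun]
    exact pow_pos hN _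
  let f : ConstantWeight k a → ConstantWeight k a → Fin k → Bool := fun x y => boolJoin x.1 y.1
  let star : V → (Fin k → Bool) → Finset V → Finset (V → ConstantWeight k a) := fun u z W =>
    Finset.univ.filter fun A => ∀ w ∈ W, f (A u) (A w) = z
  let matching : (Fin k → Bool) → Finset (V × V) → Finset (V → ConstantWeight k a) := fun z M =>
    Finset.univ.filter fun A => ∀ p ∈ M, f (A p.1) (A p.2) = z
  let nbr : V → Finset V := fun u => Finset.univ.filter fun w => (u, w) ∈ P
  let S : Finset (V → ConstantWeight k a) := X.biUnion fun u => Finset.univ.biUnion fun z =>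
    ((nbr u).powersetCard l).biUnion fun W => star u z W
  have hz : (Finset.univ : Finset (Fin k → Bool)).card = 2 ^ k := by simp
  have h2k : (2 : ℕ) ^ (2 * k) = 2 ^ k * 2 ^ k := by rw [two_mul, pow_add]
  have h4τ : (2 : ℕ) ^ (4 * τ) = (2 ^ τ * 2 ^ τ) ^ 2 := by rw [← pow_add, ← pow_mul]; congr 1; ring
  have hS : 4 * S.card ≤ Ω := by
    have hβ := Nat.div_mul_le_self (Ω * (2 ^ a) ^ l) (N ^ l)
    set β := Ω * (2 ^ a) ^ l / N ^ l
    -- `c` counts centres and joins, `d ^ l` bounds the choices of leaves.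
    refine four_mul_card_le (c := X.card * 2 ^ k) (d := D) hN ?_ hβ ?_ (τ := τ) ?_ hl
    · rw [mul_assoc]
      refine Finset.card_biUnion_le_card_mul _ _ _ fun u hu => ?_
      rw [← hz]
      refine Finset.card_biUnion_le_card_mul _ _ _ fun z _ => ?_
      refine (Finset.card_biUnion_le_card_mul _ _ β fun W hW => ?_).trans
        (Nat.mul_le_mul_right _ ?_)
      · obtain ⟨hWs, hWc⟩ := Finset.mem_powersetCard.1 hW
        rw [Nat.le_div_iff_mul_le (pow_pos hN _), ← hWc]
        refine card_star_mul_le f z (fun b => card_join_eq_le b z) u W fun h => ?_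
        exact hne _ (Finset.mem_filter.1 (hWs h)).2 rfl
      · rw [Finset.card_powersetCard]
        exact (Nat.choose_le_pow _ _).trans (Nat.pow_le_pow_left (hD u hu) _)
    · rw [h2k]
      gcongr
    · have h : (D * 2 ^ a * 2 ^ τ * 2 ^ τ) ^ 2 * 2 ^ k ≤ (N * 2 ^ τ) ^ 2 * 2 ^ k :=
        calc _ = D ^ 2 * 2 ^ (4 * τ) * ((2 ^ a) ^ 2 * 2 ^ k) := by rw [h4τ]; ring
          _ ≤ 2 ^ k * (N ^ 2 * (k + 1) ^ 2) := Nat.mul_le_mul hD2 ha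
          _ ≤ 2 ^ k * (N ^ 2 * (2 ^ τ) ^ 2) := by gcongr
          _ = _ := by ring
      have h' := Nat.le_of_mul_le_mul_right h (by positivity)
      exact Nat.le_of_mul_le_mul_right ((Nat.pow_le_pow_iff_left two_ne_zero).1 h') (by positivity)
  let T : Finset (V → ConstantWeight k a) := Finset.univ.biUnion fun z =>
    (Finset.univ.filter fun M => M ∈ P.powersetCard l ∧ ∀ p ∈ M, ∀ q ∈ M, p ≠ q →
      p.1 ≠ q.1 ∧ p.1 ≠ q.2 ∧ p.2 ≠ q.1 ∧ p.2 ≠ q.2).biUnion fun M => matching z M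
  obtain ⟨Q, hQ, hQN⟩ : ∃ Q, (∀ z, (Finset.univ.filter fun p : ConstantWeight k a ×
      ConstantWeight k a => f p.1 p.2 = z).card ≤ Q) ∧ Q * 2 ^ k ≤ N ^ 2 * (k + 1) ^ 2 :=
    ⟨N ^ 2 * (k + 1) ^ 2 / 2 ^ k, fun z => (Nat.le_div_iff_mul_le (by positivity)).2 (hQ z),
      Nat.div_mul_le_self _ _⟩
  have hT : 4 * T.card ≤ Ω := by
    have hβ := Nat.div_mul_le_self (Ω * Q ^ l) ((N ^ 2) ^ l)
    set β := Ω * Q ^ l / (N ^ 2) ^ l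
    refine four_mul_card_le (c := 2 ^ k) (d := P.card) (pow_pos hN 2) ?_ hβ ?_ (τ := τ) ?_ hl
    · rw [← hz]
      refine Finset.card_biUnion_le_card_mul _ _ _ fun z _ => ?_
      refine (Finset.card_biUnion_le_card_mul _ _ β fun M hM => ?_).trans
        (Nat.mul_le_mul_right _ ?_)
      · obtain ⟨hM, hM'⟩ := (Finset.mem_filter.1 hM).2
        obtain ⟨hMs, hMc⟩ := Finset.mem_powersetCard.1 hM
        rw [Nat.le_div_iff_mul_le (pow_pos (pow_pos hN 2) _), ← hMc]
        exact card_matching_mul_le f z (hQ z) M ⟨fun p hp => hne p (hMs hp), hM'⟩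
      · refine (Finset.card_le_card (t := P.powersetCard l)
          fun M hM => (Finset.mem_filter.1 hM).2.1).trans ?_
        rw [Finset.card_powersetCard]
        exact Nat.choose_le_pow _ _
    · exact Nat.pow_le_pow_right two_pos (by omega)
    · have h : P.card * Q * 2 ^ τ * (2 ^ τ * 2 ^ τ * 2 ^ τ * 2 ^ k) ≤
          N ^ 2 * (2 ^ τ * 2 ^ τ * 2 ^ τ * 2 ^ k) :=
        calc _ = P.card * 2 ^ (4 * τ) * (Q * 2 ^ k) := by rw [h4τ]; ring
          _ ≤ 2 ^ k * (N ^ 2 * (k + 1) ^ 2) := Nat.mul_le_mul hP hQN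
          _ ≤ 2 ^ k * (N ^ 2 * (2 ^ τ) ^ 2) := by gcongr
          _ = N ^ 2 * (1 * (2 ^ τ * 2 ^ τ) * 2 ^ k) := by ring
          _ ≤ N ^ 2 * (2 ^ τ * (2 ^ τ * 2 ^ τ) * 2 ^ k) := by
            gcongr
            exact Nat.one_le_two_pow
          _ = _ := by ring
      exact Nat.le_of_mul_le_mul_right h (by positivity)
  obtain ⟨A, hA⟩ : ∃ A, A ∉ S ∪ T := by
    by_contra! h
    have h1 : Ω ≤ (S ∪ T).card := by
      rw [hΩ, ← Finset.card_univ]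
      exact Finset.card_le_card fun A _ => h A
    have := Finset.card_union_le S T
    omega
  simp only [Finset.mem_union, not_or] at hA
  refine ⟨fun v => (A v).1, fun z => ⟨fun u hu W hW => ?_, fun M hM hM' hMz => ?_⟩⟩
  · by_contra! h
    obtain ⟨W', hW', hc⟩ := Finset.exists_subset_card_eq h
    refine hA.1 (Finset.mem_biUnion.2 ⟨u, hu, Finset.mem_biUnion.2 ⟨z, Finset.mem_univ _,
      Finset.mem_biUnion.2 ⟨W', Finset.mem_powersetCard.2 ⟨fun w hw => ?_, hc⟩, ?_⟩⟩⟩)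
    · exact Finset.mem_filter.2 ⟨Finset.mem_univ _, (hW w (hW' hw)).1⟩
    · exact Finset.mem_filter.2 ⟨Finset.mem_univ _, fun w hw => (hW w (hW' hw)).2⟩
  · by_contra! h
    obtain ⟨M', hs, hc⟩ := Finset.exists_subset_card_eq h
    refine hA.2 (Finset.mem_biUnion.2 ⟨z, Finset.mem_univ _, Finset.mem_biUnion.2 ⟨M',
      Finset.mem_filter.2 ⟨Finset.mem_univ _, Finset.mem_powersetCard.2 ⟨hs.trans hM, hc⟩,
        (hM'.subset hs).2⟩, ?_⟩⟩)
    exact Finset.mem_filter.2 ⟨Finset.mem_univ _, fun p hp => hMz p (hs hp)⟩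

/-- A set of pairs without large stars and matchings is small. -/
lemma card_edges_le {V : Type*} [Fintype V] [DecidableEq V] (F : Finset (V × V)) (X : Finset V)
    {l : ℕ} (hne : ∀ p ∈ F, p.1 ≠ p.2) (hsymm : ∀ p ∈ F, p.swap ∈ F) (hX : ∀ p ∈ F, p.1 ∈ X)
    (hstar : ∀ u ∈ X, ∀ W : Finset V, (∀ w ∈ W, (u, w) ∈ F) → W.card ≤ l)
    (hmatch : ∀ M ⊆ F, IsPairMatching M → M.card ≤ l) :
    (F.image fun p => s(p.1, p.2)).card ≤ 2 * l ^ 2 := by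
  -- The endpoints of a maximal matching cover all edges, so at most `2 * l` stars suffice.
  obtain ⟨M, hM, hmax⟩ := (Finset.univ.filter fun M : Finset (V × V) => M ⊆ F ∧
    ∀ p ∈ M, ∀ q ∈ M, p ≠ q → p.1 ≠ q.1 ∧ p.1 ≠ q.2 ∧ p.2 ≠ q.1 ∧ p.2 ≠ q.2).exists_maximal
      ⟨∅, by simp⟩
  simp only [Finset.mem_filter, Finset.mem_univ, true_and] at hM hmax
  have hMc : M.card ≤ l := hmatch M hM.1 ⟨fun p hp => hne p (hM.1 hp), hM.2⟩
  let C : Finset V := M.image Prod.fst ∪ M.image Prod.snd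
  have hCc : C.card ≤ 2 * l := by
    refine (Finset.card_union_le _ _).trans ?_
    have h1 := Finset.card_image_le (s := M) (f := Prod.fst)
    have h2 := Finset.card_image_le (s := M) (f := Prod.snd)
    omega
  have hCX : ∀ u ∈ C, u ∈ X := by
    intro u hu
    rcases Finset.mem_union.1 hu with h | h
    · obtain ⟨p, hp, rfl⟩ := Finset.mem_image.1 h
      exact hX p (hM.1 hp)
    · obtain ⟨p, hp, rfl⟩ := Finset.mem_image.1 h
      exact hX _ (hsymm p (hM.1 hp))
  have hcover : ∀ p ∈ F, p.1 ∈ C ∨ p.2 ∈ C := by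
    intro p hp
    by_contra! h
    have hnot : ∀ q ∈ M, p.1 ≠ q.1 ∧ p.1 ≠ q.2 ∧ p.2 ≠ q.1 ∧ p.2 ≠ q.2 := by
      intro q hq
      have h1 : q.1 ∈ C := Finset.mem_union_left _ (Finset.mem_image_of_mem _ hq)
      have h2 : q.2 ∈ C := Finset.mem_union_right _ (Finset.mem_image_of_mem _ hq)
      refine ⟨?_, ?_, ?_, ?_⟩ <;> intro e
      exacts [h.1 (e ▸ h1), h.1 (e ▸ h2), h.2 (e ▸ h1), h.2 (e ▸ h2)]
    have hpM : p ∈ M := by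
      refine hmax (y := insert p M) ⟨Finset.insert_subset hp hM.1, ?_⟩
        (Finset.subset_insert _ _) (Finset.mem_insert_self _ _)
      intro q hq r hr hqr
      obtain hq | hq := Finset.mem_insert.1 hq <;> obtain hr | hr := Finset.mem_insert.1 hr
      · exact absurd (hq.trans hr.symm) hqr
      · exact hq ▸ hnot r hr
      · obtain ⟨h1, h2, h3, h4⟩ := hnot q hq
        exact hr ▸ ⟨h1.symm, h3.symm, h2.symm, h4.symm⟩
      · exact hM.2 q hq r hr hqr
    exact h.1 (Finset.mem_union_left _ (Finset.mem_image_of_mem _ hpM))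
  have hsub : (F.image fun p => s(p.1, p.2)) ⊆ C.biUnion fun u =>
      (Finset.univ.filter fun w => (u, w) ∈ F).image fun w => s(u, w) := by
    intro e he
    obtain ⟨p, hp, rfl⟩ := Finset.mem_image.1 he
    rcases hcover p hp with h | h
    · exact Finset.mem_biUnion.2 ⟨_, h, Finset.mem_image.2 ⟨p.2, by simpa using hp, rfl⟩⟩
    · exact Finset.mem_biUnion.2 ⟨_, h, Finset.mem_image.2
        ⟨p.1, Finset.mem_filter.2 ⟨Finset.mem_univ _, hsymm p hp⟩, Sym2.eq_swap⟩⟩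
  calc _ ≤ _ := Finset.card_le_card hsub
    _ ≤ C.card * l := Finset.card_biUnion_le_card_mul _ _ _ fun u hu =>
        Finset.card_image_le.trans (hstar u (hCX u hu) _ fun w hw => (Finset.mem_filter.1 hw).2)
    _ ≤ 2 * l * l := Nat.mul_le_mul_right _ hCc
    _ = 2 * l ^ 2 := by ring

end CodeExistence

/-! ### The three-stage algorithm -/

section ThreeStages

/-- If all edges lie inside a set `X` with few edges, a random constant-weight code leaves a bounded
number of candidates. -/
lemma Identifiable.of_subset_inner {V : Type*} [Finite V] [Nonempty (Sym2 V)] {G : SimpleGraph V}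
    {E : Set (Sym2 V)} (hE : E ⊆ G.edgeSet) (X : Set V) (hX : ∀ e ∈ E, ∀ v ∈ e, v ∈ X)
    {k τ l D : ℕ} (hD0 : 1 ≤ D) (hD : ∀ v ∈ X, (G.neighborSet v).ncard ≤ D)
    (hk : X.ncard * D * 2 ^ (4 * τ) ≤ 2 ^ k) (hτ : k + 1 ≤ 2 ^ τ) (hl : 2 * k + 2 ≤ τ * l) :
    Identifiable 2 E (k + 2 * l ^ 2) := by
  classical
  have := Fintype.ofFinite V
  set Y : Finset V := X.toFinset with hY
  have hXY : X.ncard = Y.card := Set.ncard_eq_toFinset_card' X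
  rw [hXY] at hk
  let P : Finset (V × V) := Finset.univ.filter fun p => p.1 ∈ Y ∧ p.2 ∈ Y ∧ G.Adj p.1 p.2
  have hnb : ∀ u ∈ Y, (Finset.univ.filter fun w => (u, w) ∈ P).card ≤ D := by
    intro u hu
    refine le_trans ?_ (hD u (Set.mem_toFinset.1 hu))
    rw [Set.ncard_eq_toFinset_card']
    refine Finset.card_le_card fun w hw => ?_
    simp only [P, Finset.mem_filter, Finset.mem_univ, true_and] at hw
    simpa using hw.2.2
  have hnbY : ∀ u ∈ Y, (Finset.univ.filter fun w => (u, w) ∈ P).card ≤ Y.card := by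
    intro u hu
    refine Finset.card_le_card fun w hw => ?_
    simp only [P, Finset.mem_filter, Finset.mem_univ, true_and] at hw
    exact hw.2.1
  have hPc : P.card ≤ Y.card * D := by
    have hsub : P ⊆ Y.biUnion fun u =>
        (Finset.univ.filter fun w => (u, w) ∈ P).image fun w => (u, w) := by
      intro p hp
      exact Finset.mem_biUnion.2 ⟨p.1, (Finset.mem_filter.1 hp).2.1,
        Finset.mem_image.2 ⟨p.2, Finset.mem_filter.2 ⟨Finset.mem_univ _, hp⟩, rfl⟩⟩
    exact (Finset.card_le_card hsub).trans (Finset.card_biUnion_le_card_mul _ _ _ fun u hu =>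
      Finset.card_image_le.trans (hnb u hu))
  -- The minimum is used because its square is at most `Y.card * D`, the only quantity bounded by
  -- `hk`.
  obtain ⟨A, hA⟩ := exists_code P Y (k := k) (τ := τ) (l := l) (D := min D Y.card)
    (le_trans (by
      rw [mul_assoc]
      exact Nat.le_mul_of_pos_right _ (by positivity)) hk)
    (le_trans (Nat.mul_le_mul_right _ hPc) hk)
    (fun p hp => (Finset.mem_filter.1 hp).2.2.2.ne)
    (fun u hu => le_min (hnb u hu) (hnbY u hu))
    (le_trans (Nat.mul_le_mul_right _ (by
      rw [pow_two, mul_comm Y.card]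
      exact Nat.mul_le_mul (min_le_left _ _) (min_le_right _ _))) hk) hτ hl
  refine .stage (fun i => {v | A v i = true}) fun o => ?_
  let F : Finset (V × V) := P.filter fun p => boolJoin (A p.1) (A p.2) = o
  have hF := card_edges_le F Y (l := l) (fun p hp => (Finset.mem_filter.1
      (Finset.mem_filter.1 hp).1).2.2.2.ne)
    (by
      intro p hp
      simp only [F, P, Finset.mem_filter, Finset.mem_univ, true_and] at hp ⊢
      refine ⟨⟨hp.1.2.1, hp.1.1, hp.1.2.2.symm⟩, ?_⟩
      rw [← hp.2]
      funext i
      exact Bool.or_comm _ _)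
    (fun p hp => (Finset.mem_filter.1 (Finset.mem_filter.1 hp).1).2.1)
    (fun u hu W hW => ((hA o).1 u hu W fun w hw => Finset.mem_filter.1 (hW w hw)).le)
    (fun M hM hM' => ((hA o).2 M (hM.trans (Finset.filter_subset _ _)) hM' fun p hp =>
      (Finset.mem_filter.1 (hM hp)).2).le)
  refine Identifiable.of_ncard_le (Set.toFinite _)
    (fun e he => G.not_isDiag_of_mem_edgeSet (hE he.1)) (le_trans ?_ hF)
  rw [← Set.ncard_coe_finset]
  refine Set.ncard_le_ncard ?_ (Set.toFinite _)
  rintro e ⟨he, ho⟩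
  induction e with
  | h u v =>
    refine Finset.mem_coe.2 (Finset.mem_image.2 ⟨(u, v), ?_, rfl⟩)
    simp only [F, P, Finset.mem_filter, Finset.mem_univ, true_and, hY, Set.mem_toFinset]
    refine ⟨⟨hX _ he u (by simp), hX _ he v (by simp), hE he⟩, ?_⟩
    rw [← ho]
    funext i
    rw [Bool.eq_iff_iff, testOutcome_mk_eq_true]
    simp [boolJoin]

lemma sum_ncard_neighborSet {V : Type*} [Fintype V] (G : SimpleGraph V) :
    ∑ v, (G.neighborSet v).ncard = 2 * G.edgeSet.ncard := by
  classical
  rw [← SimpleGraph.coe_edgeFinset, Set.ncard_coe_finset, ← G.sum_degrees_eq_twice_card_edges]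
  refine Finset.sum_congr rfl fun v _ => ?_
  rw [Set.ncard_eq_toFinset_card']
  rfl

lemma ncard_mul_le_of_le_degree {V : Type*} [Finite V] (G : SimpleGraph V) (X : Set V) {d : ℕ}
    (h : ∀ v ∈ X, d ≤ (G.neighborSet v).ncard) : X.ncard * d ≤ 2 * G.edgeSet.ncard := by
  classical
  have := Fintype.ofFinite V
  rw [← sum_ncard_neighborSet, Set.ncard_eq_toFinset_card', ← smul_eq_mul]
  exact (Finset.card_nsmul_le_sum _ _ _ fun v hv => h v (Set.mem_toFinset.1 hv)).trans
    (Finset.sum_le_sum_of_subset (Finset.subset_univ _))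

/-- A first stage that determines the orders of magnitude of the degrees of both endpoints reduces
the problem to the cases of equal and of different magnitudes. -/
lemma identifiable_edgeSet {V : Type*} [Finite V] [Nonempty (Sym2 V)] (G : SimpleGraph V)
    {L q r l : ℕ} (hL : G.edgeSet.ncard < 2 ^ L) (hq : 0 < q) (hr : L + 1 < r * q)
    (hk : L + 1 + 5 * q + 1 ≤ 2 ^ q) (hl : 2 * (L + 1 + 5 * q) + 2 ≤ q * l) :
    Identifiable 3 G.edgeSet (r + (L + 1 + 5 * q + 2 * l ^ 2)) := by
  classical
  have := Fintype.ofFinite V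
  let deg : V → ℕ := fun v => (G.neighborSet v).ncard
  let cls : V → ℕ := fun v => Nat.log 2 (deg v) / q
  let X : ℕ → Set V := fun i => {v | 0 < deg v ∧ cls v = i}
  have hdegX : ∀ i, ∀ v ∈ X i, 2 ^ (i * q) ≤ deg v := by
    rintro i v ⟨hv, rfl⟩
    exact (Nat.pow_le_pow_right two_pos (Nat.div_mul_le_self _ _)).trans
      (Nat.pow_log_le_self 2 hv.ne')
  have hdegX' : ∀ i, ∀ v ∈ X i, deg v ≤ 2 ^ ((i + 1) * q) := by
    rintro i v ⟨hv, rfl⟩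
    refine (Nat.lt_pow_succ_log_self one_lt_two (deg v)).le.trans
      (Nat.pow_le_pow_right two_pos ?_)
    rw [mul_comm]
    exact Nat.lt_mul_div_succ _ hq
  have hXc : ∀ i, (X i).ncard * 2 ^ (i * q) ≤ 2 ^ (L + 1) := fun i =>
    (ncard_mul_le_of_le_degree G (X i) (hdegX i)).trans (by rw [pow_succ]; omega)
  have hpos : ∀ {u v}, s(u, v) ∈ G.edgeSet → 0 < deg u ∧ 0 < deg v := by
    intro u v h
    exact ⟨(Set.ncard_pos (Set.toFinite _)).2 ⟨v, h⟩,
      (Set.ncard_pos (Set.toFinite _)).2 ⟨u, SimpleGraph.Adj.symm h⟩⟩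
  have hjq : ∀ v, 0 < deg v → cls v * q ≤ L + 1 := by
    intro v hv
    have hXv : 1 ≤ (X (cls v)).ncard := (Set.ncard_pos (Set.toFinite _)).2 ⟨v, hv, rfl⟩
    rw [← Nat.pow_le_pow_iff_right one_lt_two]
    exact (Nat.le_mul_of_pos_left _ hXv).trans (hXc _)
  have hlt : ∀ v, 0 < deg v → cls v < r := fun v hv =>
    Nat.lt_of_mul_lt_mul_right ((hjq v hv).trans_lt hr)
  refine .stage (fun i : Fin r => X i) fun o => ?_
  set F := {e ∈ G.edgeSet | (fun i : Fin r => testOutcome e (X i)) = o} with hF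
  have hFG : F ⊆ G.edgeSet := Set.sep_subset _ _
  obtain h0 | ⟨e, he⟩ := F.eq_empty_or_nonempty
  · exact (Identifiable.add_stages (by simp [h0]) 2).mono subset_rfl (Nat.zero_le _)
  -- Equal outcomes mean equal sets of endpoint classes, so one candidate `e` reveals the classes of
  -- all.
  have hcls : ∀ {x y u v}, s(x, y) ∈ F → s(u, v) ∈ F →
      (cls x = cls u ∨ cls y = cls u) ∧ (cls x = cls v ∨ cls y = cls v) := by
    intro x y u v hx hu
    have hxp := hpos hx.1
    have hup := hpos hu.1
    constructor
    · have h := congrFun (hx.2.trans hu.2.symm) ⟨cls u, hlt u hup.1⟩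
      rw [Bool.eq_iff_iff, testOutcome_mk_eq_true, testOutcome_mk_eq_true] at h
      exact (h.2 (Or.inl ⟨hup.1, rfl⟩)).imp And.right And.right
    · have h := congrFun (hx.2.trans hu.2.symm) ⟨cls v, hlt v hup.2⟩
      rw [Bool.eq_iff_iff, testOutcome_mk_eq_true, testOutcome_mk_eq_true] at h
      exact (h.2 (Or.inr ⟨hup.2, rfl⟩)).imp And.right And.right
  obtain ⟨u, v, rfl, huv⟩ : ∃ u v, e = s(u, v) ∧ cls u ≤ cls v := by
    induction e with
    | h u v =>
      rcases le_total (cls u) (cls v) with h | h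
      exacts [⟨u, v, rfl, h⟩, ⟨v, u, Sym2.eq_swap, h⟩]
  have hup := hpos he.1
  have hjq := hjq v hup.2
  have hXv' : (X (cls v)).ncard ≤ 2 ^ (L + 1 - cls v * q) := by
    have h := hXc (cls v)
    rw [← Nat.sub_add_cancel hjq, pow_add] at h
    exact Nat.le_of_mul_le_mul_right h (by positivity)
  rcases huv.lt_or_eq with huv | huv
  · refine (Identifiable.of_cut hFG (X (cls v)) ?_ hXv' (hdegX' _)).mono subset_rfl ?_
    · intro f hf
      induction f with
      | h x y =>
        have hxp := hpos hf.1
        obtain ⟨h1, h2⟩ := hcls hf he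
        rcases h2 with h2 | h2
        · exact ⟨y, fun h => by have := h.2; omega, x, ⟨hxp.1, h2⟩, Sym2.eq_swap⟩
        · exact ⟨x, fun h => by have := h.2; omega, y, ⟨hxp.2, h2⟩, rfl⟩
    · rw [add_mul]
      omega
  · refine Identifiable.of_subset_inner hFG (X (cls v)) ?_ Nat.one_le_two_pow (hdegX' _) ?_ hk hl
    · intro f hf w hw
      induction f with
      | h x y =>
        have hxp := hpos hf.1
        obtain ⟨h1, h2⟩ := hcls he hf
        rcases Sym2.mem_iff.1 hw with rfl | rfl
        · exact ⟨hxp.1, by omega⟩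
        · exact ⟨hxp.2, by omega⟩
    · refine (Nat.mul_le_mul_right _ (Nat.mul_le_mul_right _ hXv')).trans ?_
      rw [← pow_add, ← pow_add]
      refine Nat.pow_le_pow_right two_pos ?_
      rw [add_mul]
      omega

end ThreeStages

/-! ### Choice of parameters and the limit -/

section Asymptotics

universe u

/-- Every graph with `m ≥ 1` edges has a three-stage algorithm with at most `b` tests. -/
def IsThreeStageBound (m b : ℕ) : Prop :=
  ∀ (V : Type u) [Finite V] (G : SimpleGraph V), G.edgeSet.Nonempty → G.edgeSet.ncard = m →
    Identifiable 3 G.edgeSet b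

/-- Ensures that the infimum defining `threeStageTests` is attained. -/
lemma isThreeStageBound_self (m : ℕ) : IsThreeStageBound.{u} m m := by
  intro V _ G hG hm
  have : Nonempty (Sym2 V) := ⟨hG.some⟩
  have h : Identifiable 1 G.edgeSet m := .of_ncard_le (Set.toFinite _)
    (fun e he => G.not_isDiag_of_mem_edgeSet he) hm.le
  have h2 : Identifiable 2 G.edgeSet (0 + m) :=
    .stage Fin.elim0 fun o => h.mono (Set.sep_subset _ _) le_rfl
  have h3 : Identifiable 3 G.edgeSet (0 + (0 + m)) :=
    .stage Fin.elim0 fun o => h2.mono (Set.sep_subset _ _) le_rfl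
  exact h3.mono subset_rfl (by omega)

/-- A single edge has logarithm 0, so the final bound allows no test at all. -/
lemma isThreeStageBound_one : IsThreeStageBound.{u} 1 0 := by
  intro V _ G hG hm
  have : Nonempty (Sym2 V) := ⟨hG.some⟩
  refine .add_stages ?_ 3
  obtain ⟨e, he⟩ := Set.ncard_eq_one.1 hm
  rw [he]
  exact Set.subsingleton_singleton

lemma sq_le_two_pow {n : ℕ} (hn : 4 ≤ n) : n ^ 2 ≤ 2 ^ n := by
  induction n, hn using Nat.le_induction with
  | base => norm_num
  | succ n hn ih =>
    rw [pow_succ 2]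
    nlinarith

lemma isThreeStageBound_of_lt {m L R : ℕ} (hm : m < 2 ^ L) (hR : 0 < R) (hL : R * (R + 6) ≤ L) :
    IsThreeStageBound.{u} m (L + 5 * (L / R) + (R + 7 + 2 * (2 * R + 12) ^ 2)) := by
  intro V _ G hG hGm
  have : Nonempty (Sym2 V) := ⟨hG.some⟩
  have h1 : L < R * (L / R + 1) := Nat.lt_mul_div_succ L hR
  have h2 : R + 6 ≤ L / R := (Nat.le_div_iff_mul_le hR).2 (by rw [mul_comm]; exact hL)
  -- With `q = L / R + 1`, one has `L + 1 ≤ R * q` and `R + 7 ≤ q`. Hence the code length plus one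
  -- is at most `(R + 6) * q ≤ q ^ 2 ≤ 2 ^ q`, and `l = 2 * R + 12` is large enough.
  refine (identifiable_edgeSet G (L := L) (q := L / R + 1) (r := R + 1) (l := 2 * R + 12)
    (hGm ▸ hm) (Nat.succ_pos _) ?_ ?_ ?_).mono subset_rfl ?_
  · nlinarith
  · refine le_trans ?_ (sq_le_two_pow (by omega))
    nlinarith
  · nlinarith
  · omega

/-- The number of tests that suffice for all graphs with `m` edges. -/
noncomputable def threeStageTests (m : ℕ) : ℕ := sInf {b | IsThreeStageBound.{u} m b}

lemma isThreeStageBound_threeStageTests (m : ℕ) :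
    IsThreeStageBound.{u} m (threeStageTests.{u} m) :=
  Nat.sInf_mem (s := {b | IsThreeStageBound.{u} m b}) ⟨m, isThreeStageBound_self m⟩

lemma IsThreeStageBound.threeStageTests_le {m b : ℕ} (h : IsThreeStageBound.{u} m b) :
    threeStageTests.{u} m ≤ b :=
  Nat.sInf_le (m := b) (s := {b | IsThreeStageBound.{u} m b}) h

lemma threeStageTests_le {m R : ℕ} (hR : 0 < R) (hm : 2 ^ (R * (R + 6)) ≤ m) :
    (threeStageTests.{u} m : ℝ) ≤ (Real.logb 2 m + 1) * (1 + 5 / R) +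
      (R + 7 + 2 * (2 * R + 12) ^ 2) := by
  have hm0 : m ≠ 0 := by
    have := Nat.two_pow_pos (R * (R + 6))
    omega
  have hL : R * (R + 6) ≤ Nat.log 2 m + 1 :=
    (Nat.le_log_of_pow_le one_lt_two hm).trans (Nat.le_succ _)
  have h := (isThreeStageBound_of_lt.{u} (Nat.lt_pow_succ_log_self one_lt_two m) hR
    hL).threeStageTests_le
  have h' : (threeStageTests.{u} m : ℝ) ≤ ((Nat.log 2 m + 1 : ℕ) +
      5 * ((Nat.log 2 m + 1) / R : ℕ) + (R + 7 + 2 * (2 * R + 12) ^ 2) : ℝ) := by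
    exact_mod_cast h
  have hlog : ((Nat.log 2 m + 1 : ℕ) : ℝ) ≤ Real.logb 2 m + 1 := by
    have := Real.natLog_le_logb m 2
    push_cast at this ⊢
    linarith
  have hdiv : (((Nat.log 2 m + 1) / R : ℕ) : ℝ) ≤ (Real.logb 2 m + 1) / R :=
    Nat.cast_div_le.trans (by gcongr)
  calc _ ≤ _ := h'
    _ ≤ (Real.logb 2 m + 1) + 5 * ((Real.logb 2 m + 1) / R) + (R + 7 + 2 * (2 * R + 12) ^ 2) := by
      gcongr
    _ = _ := by ring

/-- The relative excess of the number of tests over the information-theoretic bound. -/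
noncomputable def threeStageExcess (m : ℕ) : ℝ :=
  max 0 (threeStageTests.{u} m / Real.logb 2 m - 1)

lemma tendsto_threeStageExcess : Tendsto threeStageExcess.{u} atTop (𝓝 0) := by
  have hlog : Tendsto (fun m : ℕ => Real.logb 2 m) atTop atTop :=
    (Real.tendsto_logb_atTop one_lt_two).comp tendsto_natCast_atTop_atTop
  rw [Metric.tendsto_atTop']
  intro ε hε
  obtain ⟨R, hR⟩ := exists_nat_gt (10 / ε)
  have hR0 : (0 : ℝ) < R := lt_trans (by positivity) hR
  have hRε : 5 / (R : ℝ) < ε / 2 := by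
    rw [div_lt_iff₀ hε] at hR
    rw [div_lt_iff₀ hR0]
    linarith
  set C : ℝ := 1 + 5 / R + (R + 7 + 2 * (2 * R + 12) ^ 2) with hC
  obtain ⟨N, hN⟩ := eventually_atTop.1 (hlog.eventually_gt_atTop (max 0 (2 * C / ε)))
  refine ⟨max N (2 ^ (R * (R + 6))), fun m hm => ?_⟩
  have hmN := hN m ((le_max_left _ _).trans hm.le)
  have h0 : 0 < Real.logb 2 m := (le_max_left _ _).trans_lt hmN
  have h1 : 2 * C / ε < Real.logb 2 m := (le_max_right _ _).trans_lt hmN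
  have hb := threeStageTests_le.{u} (Nat.cast_pos.1 hR0) ((le_max_right _ _).trans hm.le)
  rw [div_lt_iff₀ hε] at h1
  have hlt : (threeStageTests.{u} m : ℝ) / Real.logb 2 m - 1 < ε := by
    rw [sub_lt_iff_lt_add, div_lt_iff₀ h0]
    have := mul_lt_mul_of_pos_left hRε h0
    calc _ ≤ _ := hb
      _ = Real.logb 2 m + Real.logb 2 m * (5 / R) + C := by rw [hC]; ring
      _ < _ := by linarith
  -- Truncation at 0 makes the upper estimate sufficient; no lower bound on the number of tests is
  -- needed.
  rw [Real.dist_eq, sub_zero, threeStageExcess, abs_of_nonneg (le_max_left _ _)]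
  exact max_lt hε hlt

lemma threeStageTests_le_logb_mul {m : ℕ} (hm : 0 < m) :
    (threeStageTests.{u} m : ℝ) ≤ Real.logb 2 m * (1 + threeStageExcess.{u} m) := by
  obtain rfl | hm1 := Nat.eq_or_lt_of_le hm
  · have h : threeStageTests.{u} 1 ≤ 0 := isThreeStageBound_one.threeStageTests_le
    simp [Nat.le_zero.1 h]
  · have h0 : 0 < Real.logb 2 m := Real.logb_pos one_lt_two (by exact_mod_cast hm1)
    have h := le_max_right 0 ((threeStageTests.{u} m : ℝ) / Real.logb 2 m - 1)
    rw [← div_le_iff₀' h0, threeStageExcess]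
    linarith

end Asymptotics

theorem theorem3 :
    ∃ o : ℕ → ℝ, Tendsto o atTop (𝓝 0) ∧
      ∀ (V : Type*) [Finite V] (G : SimpleGraph V), G.edgeSet.Nonempty →
        ∃ A : StagedAlgorithm V 3, A.FindsDefectiveEdge G ∧
          ∀ e ∈ G.edgeSet,
            (A.numTests e : ℝ) ≤
              Real.logb 2 (G.edgeSet.ncard : ℝ) * (1 + o G.edgeSet.ncard) := by
  refine ⟨threeStageExcess, tendsto_threeStageExcess, fun V _ G hG => ?_⟩
  obtain ⟨A, hA⟩ := isThreeStageBound_threeStageTests G.edgeSet.ncard V G hG rfl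
  refine ⟨A, fun e he => (hA e he).1, fun e he => ?_⟩
  exact (Nat.cast_le.2 (hA e he).2).trans
    (threeStageTests_le_logb_mul ((Set.ncard_pos (Set.toFinite _)).2 hG))
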